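/- Let $\mathcal A$ be an associative, commutative, unital algebra of finite dimension over $\mathbb R$ with multiplication $\star$, equipped with a norm. Let $U\subseteq\mathcal A$ be open and simply connected, and let $f:U\to\mathcal A$ be differentiable on $U$ in the real Fréchet sense. Call $f$ $\mathcal A$-differentiable on $U$ if at every $p\in U$ its Fréchet differential $d_pf:\mathcal A\to\mathcal A$ is right-$\mathcal A$-linear, i.e. $d_pf(v\star w)=d_pf(v)\star w$ for all $v,w\in\mathcal A$. For a rectifiable curve $C$ in $U$ the integral is $$\int_C f(\zeta)\star d\zeta=\lim\sum_{i=1}^m f(\zeta_i)\star(\zeta_i-\zeta_{i-1}),$$ where $\zeta_0,\dots,\zeta_m$ are the successive points of $C$ belonging to a partition of the parameter interval, and the limit is taken as the mesh of the partition tends to $0$. Then the following are equivalent: 1. $\int_C f\star d\zeta=0$ for every rectifiable loop $C$ in $U$; 2. $\int_C f\star d\zeta=0$ for every piecewise continuously differentiable loop $C$ in $U$; 3. $f$ is $\mathcal A$-differentiable on $U$. -/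

import Mathlib

open Set

namespace AlgebraCalculus

/-- Right-linearity over the algebra `A`: the real-linear map `T` satisfies
`T (x ⋆ y) = T x ⋆ y`. -/
def IsRightLinear {A : Type*} [NormedCommRing A] [NormedAlgebra ℝ A] (T : A →L[ℝ] A) : Prop :=
  ∀ x y : A, T (x * y) = T x * y

/-- `f` is differentiable over the algebra `A` at `p`: the Fréchet quotient of `f` at `p` tends to
zero for some differential that is right-linear over `A`. -/
def ADifferentiableAt {A : Type*} [NormedCommRing A] [NormedAlgebra ℝ A]
    (f : A → A) (p : A) : Prop :=
  ∃ T : A →L[ℝ] A, IsRightLinear T ∧ HasFDerivAt f T p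

/-- `f` is differentiable over the algebra `A` at every point of the (open) set `U`. -/
def ADifferentiableOn {A : Type*} [NormedCommRing A] [NormedAlgebra ℝ A]
    (f : A → A) (U : Set A) : Prop :=
  ∀ p ∈ U, ADifferentiableAt f p

/-- `I` is the value of `∫_C f(ζ) ⋆ dζ` along the curve `C` parametrized by `γ` on `[a, b]`: the
sums `∑ f(ζ_i) ⋆ (ζ_i - ζ_{i-1})` over the points `ζ_i = γ (t i)` of a partition
`a = t 0 ≤ t 1 ≤ ⋯ ≤ t m = b` converge to `I` as the mesh of the partition tends to zero.
In particular the limit exists. -/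
def HasAIntegral {A : Type*} [NormedCommRing A] [NormedAlgebra ℝ A]
    (f : A → A) (γ : ℝ → A) (a b : ℝ) (I : A) : Prop :=
  ∀ ε > 0, ∃ δ > 0, ∀ (m : ℕ) (t : ℕ → ℝ), Monotone t → t 0 = a → t m = b →
    (∀ i < m, t (i + 1) - t i < δ) →
    ‖(∑ i ∈ Finset.range m, f (γ (t (i + 1))) * (γ (t (i + 1)) - γ (t i))) - I‖ < ε

/-- `γ` on `[a, b]` parametrizes a loop (a continuous closed curve) contained in `U`. -/
def IsLoopIn {A : Type*} [NormedCommRing A] [NormedAlgebra ℝ A]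
    (U : Set A) (γ : ℝ → A) (a b : ℝ) : Prop :=
  a ≤ b ∧ ContinuousOn γ (Icc a b) ∧ MapsTo γ (Icc a b) U ∧ γ a = γ b

/-- The curve parametrized by `γ` on `[a, b]` has finite length. -/
def IsRectifiable {A : Type*} [NormedCommRing A] [NormedAlgebra ℝ A]
    (γ : ℝ → A) (a b : ℝ) : Prop :=
  BoundedVariationOn γ (Icc a b)

/-- `γ` is piecewise continuously differentiable on `[a, b]`: there is a finite partition of
`[a, b]` such that `γ` is continuously differentiable (one-sidedly at the end points) on each of
its closed subintervals. -/
def IsPiecewiseSmooth {A : Type*} [NormedCommRing A] [NormedAlgebra ℝ A]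
    (γ : ℝ → A) (a b : ℝ) : Prop :=
  ∃ (m : ℕ) (t : ℕ → ℝ), Monotone t ∧ t 0 = a ∧ t m = b ∧
    ∀ i < m, ContDiffOn ℝ 1 γ (Icc (t i) (t (i + 1)))

end AlgebraCalculus

/-!
The `A`-valued 1-form `f(ζ) ⋆ dζ` has the derivative `(v, w) ↦ d_p f (v) ⋆ w` at `p`, so it is
closed at `p` exactly when `d_p f (v) ⋆ w = d_p f (w) ⋆ v` for all `v` and `w`. Taking `w = 1`, this
says that `d_p f` is multiplication by `d_p f (1)`, which is right-linearity over `A`. The theorem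
is therefore the equivalence of closedness and vanishing of the integrals over loops.

If the form is closed, it has local primitives on balls; the derivative of `f` need not be
continuous for this. The local primitives differ by constants on the overlaps, and the germs of
primitives form a covering space of `U` with fibre `A`. Since `U` is simply connected, this
covering has a continuous section, which is a global primitive `F`
(`IsSimplyConnected.exists_forall_hasFDerivAt_of_fderiv_symmetric`). On the compact image of a
rectifiable curve the difference quotients of `F` converge uniformly, so a fine Riemann sum
differs from the increment of `F` by a small multiple of the length of the curve
(`AlgebraCalculus.hasAIntegral_of_hasFDerivAt`). Around a loop the increment is zero.

Conversely, the integral of the linearization of `f` at `p` around the parallelogram with the sides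
`s v` and `s w` is `s² (d_p f (v) ⋆ w - d_p f (w) ⋆ v)`, and that of the remainder is `o(s²)`
(`AlgebraCalculus.norm_mul_sub_mul_le_of_hasAIntegral_zero`). If the integral of `f` vanishes, then
so does the bracket. Parallelograms are piecewise continuously differentiable, and such curves are
rectifiable, so either condition on the integrals supplies what is needed.
-/

/-! ### Primitives of 1-forms on simply connected open sets -/

/-- The bundle over `X` with discrete fibre `F` in which the coordinate `v` over `x` in the chart
`i` stands for the value `v + G i x`, so that its continuous sections are the functions that differ
from `G i` by a locally constant function on each `s i`. The hypothesis `hG` makes the coordinate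
changes locally constant in the base point, hence continuous. -/
def FiberBundleCore.ofLocallyConstantSub {X F : Type*} [TopologicalSpace X] [AddCommGroup F]
    [TopologicalSpace F] [DiscreteTopology F]
    (s : X → Set X) (hs : ∀ i, IsOpen (s i)) (hmem : ∀ i, i ∈ s i) (G : X → X → F)
    (hG : ∀ i j, ∀ x ∈ s i ∩ s j, ∀ y ∈ s i ∩ s j, G i x - G j x = G i y - G j y) :
    FiberBundleCore X X F where
  baseSet := s
  isOpen_baseSet := hs
  indexAt x := x
  mem_baseSet_at := hmem
  coordChange i j x v := v + (G i x - G j x)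
  coordChange_self i x _ v := by simp
  continuousOn_coordChange i j := by
    rintro ⟨x, v⟩ ⟨hx, -⟩
    have hc : Continuous fun q : X × F ↦ q.2 + (G i x - G j x) :=
      (continuous_of_discreteTopology (f := (· + (G i x - G j x)))).comp continuous_snd
    refine hc.continuousWithinAt.congr (fun q hq ↦ ?_) rfl
    rw [hG i j _ hq.1 _ hx]
  coordChange_comp i j k x _ v := by
    rw [add_assoc, sub_add_sub_cancel]

theorem FiberBundleCore.isCoveringMap_proj {ι B F : Type*} [TopologicalSpace B]
    [TopologicalSpace F] [DiscreteTopology F] (Z : FiberBundleCore ι B F) :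
    IsCoveringMap Z.proj :=
  IsCoveringMap.mk _ (fun _ ↦ F) Z.localTrivAt Z.mem_localTrivAt_baseSet

/-- If functions `G i` on the members of an open cover of a simply connected space differ by
constants on the overlaps, then they can be corrected by constants to agree, near each point, with
a single function `g`: `g` is a continuous section of the covering space glued from the `G i`,
which exists by lifting the identity map. -/
theorem exists_forall_eventually_eq_add_of_simplyConnectedSpace {X F : Type*}
    [TopologicalSpace X] [SimplyConnectedSpace X] [LocallyPathConnectedSpace X] [AddCommGroup F]
    (s : X → Set X) (hs : ∀ i, IsOpen (s i)) (hmem : ∀ i, i ∈ s i) (G : X → X → F)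
    (hG : ∀ i j, ∀ x ∈ s i ∩ s j, ∀ y ∈ s i ∩ s j, G i x - G j x = G i y - G j y) :
    ∃ g : X → F, ∀ i, ∃ c, ∀ᶠ x in nhds i, g x = G i x + c := by
  let _ : TopologicalSpace F := ⊥
  have : DiscreteTopology F := ⟨rfl⟩
  let Z := FiberBundleCore.ofLocallyConstantSub s hs hmem G hG
  obtain ⟨x₀⟩ : Nonempty X := inferInstance
  obtain ⟨σ, ⟨-, hσ⟩, -⟩ := Z.isCoveringMap_proj.existsUnique_continuousMap_lifts
    (ContinuousMap.id X) x₀ ⟨x₀, (0 : F)⟩ rfl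
  have hσ' (x : X) : (σ x).proj = x := congrFun hσ x
  -- `g` reads the section `σ` in the chart centred at the point itself.
  let v (x : X) : F := (σ x).2
  refine ⟨fun x ↦ v x + G x x, fun i ↦ ?_⟩
  have hsrc : σ i ∈ (Z.localTriv i).source := by
    rw [Z.mem_localTriv_source, hσ']
    exact hmem i
  have hcont : ContinuousAt (fun x ↦ ((Z.localTriv i) (σ x)).2) i :=
    continuousAt_snd.comp
      (((Z.localTriv i).continuousAt hsrc).comp σ.continuous.continuousAt)
  have hval (x : X) : ((Z.localTriv i) (σ x)).2 = v x + (G x x - G i x) := by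
    change v x + (G (σ x).proj (σ x).proj - G i (σ x).proj) = _
    rw [hσ']
  -- The coordinate of a continuous section in a fixed chart is locally constant.
  refine ⟨((Z.localTriv i) (σ i)).2, ?_⟩
  filter_upwards [hcont.preimage_mem_nhds (isOpen_discrete {((Z.localTriv i) (σ i)).2}
    |>.mem_nhds rfl)] with x hx
  have hx' : ((Z.localTriv i) (σ x)).2 = ((Z.localTriv i) (σ i)).2 := hx
  rw [← hx', hval]
  abel

/-- Two primitives of the same 1-form on a convex set differ by a constant. -/
theorem Convex.sub_eq_sub_of_hasFDerivAt_eq {E F : Type*} [NormedAddCommGroup E]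
    [NormedSpace ℝ E] [NormedAddCommGroup F] [NormedSpace ℝ F] {s : Set E} (hs : Convex ℝ s)
    {ω : E → E →L[ℝ] F} {g h : E → F} (hg : ∀ x ∈ s, HasFDerivAt g (ω x) x)
    (hh : ∀ x ∈ s, HasFDerivAt h (ω x) x) {x y : E} (hx : x ∈ s) (hy : y ∈ s) :
    g x - h x = g y - h y := by
  have := hs.norm_image_sub_le_of_norm_hasFDerivWithin_le (f := g - h) (f' := 0) (C := 0)
    (fun z hz ↦ by simpa using ((hg z hz).sub (hh z hz)).hasFDerivWithinAt) (by simp) hy hx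
  rw [zero_mul, norm_le_zero_iff, sub_eq_zero] at this
  exact this

/-- The Poincaré lemma for 1-forms: on a simply connected open set, a closed 1-form, not
necessarily continuously differentiable, has a primitive. -/
theorem IsSimplyConnected.exists_forall_hasFDerivAt_of_fderiv_symmetric {E F : Type*}
    [NormedAddCommGroup E] [NormedSpace ℝ E] [NormedAddCommGroup F] [NormedSpace ℝ F]
    [CompleteSpace F] {U : Set E} (hsc : IsSimplyConnected U) (hU : IsOpen U)
    {ω : E → E →L[ℝ] F} (hω : DifferentiableOn ℝ ω U)
    (hdω : ∀ a ∈ U, ∀ x y, fderiv ℝ ω a x y = fderiv ℝ ω a y x) :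
    ∃ g : E → F, ∀ a ∈ U, HasFDerivAt g (ω a) a := by
  classical
  have := hsc.simplyConnectedSpace
  have := hU.locallyPathConnectedSpace
  have hball (i : U) : ∃ r > 0, Metric.ball (i : E) r ⊆ U := Metric.isOpen_iff.1 hU i i.2
  choose r hr hrU using hball
  have hloc (i : U) : ∃ G : E → F, ∀ a ∈ Metric.ball (i : E) (r i), HasFDerivAt G (ω a) a :=
    (convex_ball _ _).exists_forall_hasFDerivAt_of_fderiv_symmetric Metric.isOpen_ball
      (hω.mono (hrU i)) fun a ha ↦ hdω a (hrU i ha)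
  choose G hG using hloc
  obtain ⟨g, hg⟩ := exists_forall_eventually_eq_add_of_simplyConnectedSpace
    (fun i : U ↦ (Subtype.val ⁻¹' Metric.ball (i : E) (r i) : Set U))
    (fun i ↦ Metric.isOpen_ball.preimage continuous_subtype_val)
    (fun i ↦ Metric.mem_ball_self (hr i)) (fun i x ↦ G i x)
    (fun i j x hx y hy ↦
      ((convex_ball _ _).inter (convex_ball _ _)).sub_eq_sub_of_hasFDerivAt_eq
        (fun z hz ↦ hG i z hz.1) (fun z hz ↦ hG j z hz.2) hx hy)
  refine ⟨fun x ↦ if hx : x ∈ U then g ⟨x, hx⟩ else 0, fun a ha ↦ ?_⟩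
  obtain ⟨c, hc⟩ := hg ⟨a, ha⟩
  refine ((hG ⟨a, ha⟩ a (Metric.mem_ball_self (hr _))).add_const c).congr_of_eventuallyEq ?_
  rw [nhds_subtype_eq_comap] at hc
  filter_upwards [Filter.eventually_comap.1 hc, hU.mem_nhds ha] with x hx hxU
  rw [dif_pos hxU]
  exact hx ⟨x, hxU⟩ rfl

/-! ### Riemann sums along rectifiable curves -/

namespace AlgebraCalculus

variable {A : Type*} [NormedCommRing A] [NormedAlgebra ℝ A]

theorem IsPiecewiseSmooth.isRectifiable {γ : ℝ → A} {a b : ℝ} (h : IsPiecewiseSmooth γ a b) :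
    IsRectifiable γ a b := by
  obtain ⟨m, t, ht, rfl, rfl, hγ⟩ := h
  rw [IsRectifiable, BoundedVariationOn, ← eVariationOn.sum' γ ht]
  refine ENNReal.sum_ne_top.2 fun i hi ↦ ?_
  obtain ⟨K, hK⟩ := (hγ i (Finset.mem_range.1 hi)).exists_lipschitzOnWith one_ne_zero
    (convex_Icc _ _) isCompact_Icc
  have hle : t i ≤ t (i + 1) := ht i.le_succ
  simpa [BoundedVariationOn] using
    hK.locallyBoundedVariationOn _ _ (left_mem_Icc.2 hle) (right_mem_Icc.2 hle)

/-- The difference quotients of a primitive `F` of `f(ζ) ⋆ dζ` converge uniformly on compact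
sets. -/
theorem exists_forall_norm_sub_sub_mul_le {U : Set A} (hU : IsOpen U) {f F : A → A}
    (hf : ContinuousOn f U) (hF : ∀ p ∈ U, HasFDerivAt F (ContinuousLinearMap.mul ℝ A (f p)) p)
    {K : Set A} (hK : IsCompact K) (hKU : K ⊆ U) {ε : ℝ} (hε : 0 < ε) :
    ∃ ρ > 0, ∀ y ∈ K, ∀ x, dist x y < ρ → ‖F x - F y - f y * (x - y)‖ ≤ ε * ‖x - y‖ := by
  obtain ⟨ρ₁, hρ₁, h₁⟩ := hK.exists_thickening_subset_open hU hKU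
  obtain ⟨ρ₂, hρ₂, h₂⟩ := Metric.mem_uniformity_dist.1 (hK.uniformContinuousAt_of_continuousAt f
    (fun y hy ↦ hf.continuousAt (hU.mem_nhds (hKU hy))) (Metric.dist_mem_uniformity hε))
  refine ⟨min ρ₁ ρ₂, lt_min hρ₁ hρ₂, fun y hy x hx ↦ ?_⟩
  have hball : ∀ z ∈ Metric.ball y (min ρ₁ ρ₂), z ∈ U ∧ ‖f z - f y‖ ≤ ε := fun z hz ↦ by
    rw [Metric.mem_ball, lt_min_iff] at hz
    refine ⟨h₁ (Metric.mem_thickening_iff.2 ⟨y, hy, hz.1⟩), ?_⟩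
    rw [← dist_eq_norm, dist_comm]
    exact (h₂ (by rw [dist_comm]; exact hz.2) hy).le
  refine (convex_ball y (min ρ₁ ρ₂)).norm_image_sub_le_of_norm_hasFDerivWithin_le'
    (φ := ContinuousLinearMap.mul ℝ A (f y))
    (fun z hz ↦ (hF z (hball z hz).1).hasFDerivWithinAt) (fun z hz ↦ ?_)
    (Metric.mem_ball_self (lt_min hρ₁ hρ₂)) hx
  rw [← map_sub]
  exact (ContinuousLinearMap.opNorm_mul_apply_le ℝ A _).trans (hball z hz).2

/-- If `f(ζ) ⋆ dζ` has the primitive `F`, then its integral along a rectifiable curve is the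
increment of `F`: the error of a fine Riemann sum is a small multiple of the length. -/
theorem hasAIntegral_of_hasFDerivAt {U : Set A} (hU : IsOpen U) {f F : A → A}
    (hf : ContinuousOn f U) (hF : ∀ p ∈ U, HasFDerivAt F (ContinuousLinearMap.mul ℝ A (f p)) p)
    {γ : ℝ → A} {a b : ℝ} (hγ : ContinuousOn γ (Icc a b)) (hγU : MapsTo γ (Icc a b) U)
    (hr : IsRectifiable γ a b) : HasAIntegral f γ a b (F (γ b) - F (γ a)) := by
  intro ε hε
  set V := (eVariationOn γ (Icc a b)).toReal
  have hV : 0 ≤ V := ENNReal.toReal_nonneg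
  have hη : 0 < ε / (V + 1) := by positivity
  obtain ⟨ρ, hρ, hρF⟩ := exists_forall_norm_sub_sub_mul_le hU hf hF
    (isCompact_Icc.image_of_continuousOn hγ) hγU.image_subset hη
  obtain ⟨δ, hδ, hδγ⟩ := Metric.uniformContinuousOn_iff.1
    (isCompact_Icc.uniformContinuousOn_of_continuous hγ) ρ hρ
  refine ⟨δ, hδ, fun m t ht h0 hm hmesh ↦ ?_⟩
  have htmem : ∀ i ≤ m, t i ∈ Icc a b := fun i hi ↦
    ⟨h0 ▸ ht (Nat.zero_le i), hm ▸ ht hi⟩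
  have hstep : ∀ i ∈ Finset.range m,
      ‖f (γ (t (i + 1))) * (γ (t (i + 1)) - γ (t i)) - (F (γ (t (i + 1))) - F (γ (t i)))‖ ≤
        ε / (V + 1) * dist (γ (t (i + 1))) (γ (t i)) := fun i hi ↦ by
    have hi' := Finset.mem_range.1 hi
    have h1 := htmem (i + 1) hi'
    have h2 := htmem i hi'.le
    have hd : dist (t i) (t (i + 1)) < δ := by
      rw [dist_comm, Real.dist_eq, abs_of_nonneg (sub_nonneg.2 (ht i.le_succ))]
      exact hmesh i hi'
    have := hρF _ (mem_image_of_mem γ h1) _ (hδγ _ h2 _ h1 hd)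
    rw [dist_comm, dist_eq_norm]
    convert this using 2
    rw [← neg_sub (γ (t i)) (γ (t (i + 1)))]
    ring
  have hlen : ∑ i ∈ Finset.range m, dist (γ (t (i + 1))) (γ (t i)) ≤ V := by
    have := eVariationOn.sum_le_of_monotoneOn_Iic (f := γ) (ht.monotoneOn (Iic m)) htmem
    rw [← ENNReal.ofReal_le_iff_le_toReal hr,
      ENNReal.ofReal_sum_of_nonneg fun _ _ ↦ dist_nonneg]
    simpa only [edist_dist] using this
  have htel : F (γ b) - F (γ a) = ∑ i ∈ Finset.range m, (F (γ (t (i + 1))) - F (γ (t i))) := by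
    rw [Finset.sum_range_sub (fun i ↦ F (γ (t i))), h0, hm]
  rw [htel, ← Finset.sum_sub_distrib]
  calc ‖∑ i ∈ Finset.range m, _‖
      ≤ ∑ i ∈ Finset.range m, ε / (V + 1) * dist (γ (t (i + 1))) (γ (t i)) :=
        norm_sum_le_of_le _ hstep
    _ ≤ ε / (V + 1) * V := by
        rw [← Finset.mul_sum]
        gcongr
    _ < ε := by
        rw [div_mul_eq_mul_div, div_lt_iff₀ (by positivity)]
        nlinarith

/-! ### Vanishing of the integrals of differentiable functions -/

/-- The differential of a function differentiable over `A` at `p` is multiplication by the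
derivative `d_p f (1)`. -/
theorem ADifferentiableAt.fderiv_apply {f : A → A} {p : A} (h : ADifferentiableAt f p) (v : A) :
    fderiv ℝ f p v = fderiv ℝ f p 1 * v := by
  obtain ⟨T, hT, hfT⟩ := h
  rw [hfT.fderiv, ← hT, one_mul]

/-- The 1-form `f(ζ) ⋆ dζ` is closed where `f` is differentiable over `A`, because its derivative
`(v, w) ↦ d_p f (v) ⋆ w = d_p f (1) ⋆ v ⋆ w` is symmetric. -/
theorem ADifferentiableOn.exists_primitive [CompleteSpace A] {U : Set A} (hU : IsOpen U)
    (hsc : IsSimplyConnected U) {f : A → A} (hf : ADifferentiableOn f U) :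
    ∃ F : A → A, ∀ p ∈ U, HasFDerivAt F (ContinuousLinearMap.mul ℝ A (f p)) p := by
  have hd (p : A) (hp : p ∈ U) : HasFDerivAt (fun p ↦ ContinuousLinearMap.mul ℝ A (f p))
      ((ContinuousLinearMap.mul ℝ A).comp (fderiv ℝ f p)) p := by
    obtain ⟨T, -, hT⟩ := hf p hp
    exact (ContinuousLinearMap.mul ℝ A).hasFDerivAt.comp p hT.differentiableAt.hasFDerivAt
  refine hsc.exists_forall_hasFDerivAt_of_fderiv_symmetric hU
    (fun p hp ↦ (hd p hp).differentiableAt.differentiableWithinAt) fun p hp v w ↦ ?_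
  rw [(hd p hp).fderiv]
  simp only [ContinuousLinearMap.comp_apply, ContinuousLinearMap.mul_apply']
  rw [(hf p hp).fderiv_apply v, (hf p hp).fderiv_apply w]
  ring

theorem ADifferentiableOn.hasAIntegral_zero [CompleteSpace A] {U : Set A} (hU : IsOpen U)
    (hsc : IsSimplyConnected U) {f : A → A} (hf : ADifferentiableOn f U) {γ : ℝ → A} {a b : ℝ}
    (hγ : IsLoopIn U γ a b) (hr : IsRectifiable γ a b) : HasAIntegral f γ a b 0 := by
  obtain ⟨F, hF⟩ := hf.exists_primitive hU hsc
  obtain ⟨-, hc, hm, hab⟩ := hγ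
  have hfc : ContinuousOn f U := fun p hp ↦ by
    obtain ⟨T, -, hT⟩ := hf p hp
    exact hT.continuousAt.continuousWithinAt
  simpa [hab] using hasAIntegral_of_hasFDerivAt hU hfc hF hc hm hr

end AlgebraCalculus

/-! ### Integrals along small parallelograms -/

namespace AlgebraCalculus

/-- The trapezoidal function that climbs from `0` to `1` on `[0, 1]`, is `1` on `[1, 2]` and
descends to `0` on `[2, 3]`. -/
def trapezoid (t : ℝ) : ℝ := max 0 (min 1 (min t (3 - t)))

theorem trapezoid_of_nonpos {t : ℝ} (h : t ≤ 0) : trapezoid t = 0 := by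
  simp [trapezoid, h]

theorem trapezoid_of_mem_Icc_zero_one {t : ℝ} (h : t ∈ Icc (0 : ℝ) 1) : trapezoid t = t := by
  obtain ⟨h0, h1⟩ := h
  rw [trapezoid, min_eq_left (by linarith : t ≤ 3 - t), min_eq_right h1, max_eq_right h0]

theorem trapezoid_of_mem_Icc_one_two {t : ℝ} (h : t ∈ Icc (1 : ℝ) 2) : trapezoid t = 1 := by
  obtain ⟨h1, h2⟩ := h
  rw [trapezoid, min_eq_left (le_min h1 (by linarith)), max_eq_right zero_le_one]

theorem trapezoid_three_sub (t : ℝ) : trapezoid (3 - t) = trapezoid t := by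
  rw [trapezoid, trapezoid, sub_sub_cancel, min_comm t]

theorem continuous_trapezoid : Continuous trapezoid := by
  unfold trapezoid
  fun_prop

theorem trapezoid_mem_Icc (t : ℝ) : trapezoid t ∈ Icc (0 : ℝ) 1 :=
  ⟨le_max_left _ _, max_le zero_le_one (min_le_left _ _)⟩

variable {A : Type*} [NormedCommRing A] [NormedAlgebra ℝ A]

/-- The boundary, parametrized on `[0, 4]` with one unit of time for each side, of the
parallelogram with the vertices `p`, `p + v`, `p + v + w`, `p + w`. -/
def parallelogram (p v w : A) (t : ℝ) : A := p + (trapezoid t • v + trapezoid (t - 1) • w)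

theorem continuous_parallelogram (p v w : A) : Continuous (parallelogram p v w) := by
  have := continuous_trapezoid
  unfold parallelogram
  fun_prop

theorem norm_parallelogram_sub_le (p v w : A) (t : ℝ) :
    ‖parallelogram p v w t - p‖ ≤ ‖v‖ + ‖w‖ := by
  rw [parallelogram, add_sub_cancel_left]
  refine (norm_add_le _ _).trans (add_le_add ?_ ?_) <;>
  · rw [norm_smul, Real.norm_of_nonneg (trapezoid_mem_Icc _).1]
    exact mul_le_of_le_one_left (norm_nonneg _) (trapezoid_mem_Icc _).2

/-- The initial vertex, relative to `p`, of the side of the parallelogram traversed on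
`[k, k + 1]`, for `k < 4`. -/
def parallelogramVertex (v w : A) : ℕ → A
  | 0 => 0
  | 1 => v
  | 2 => v + w
  | _ => w

/-- The side of the parallelogram traversed on `[k, k + 1]`, for `k < 4`, as a vector. -/
def parallelogramSide (v w : A) : ℕ → A
  | 0 => v
  | 1 => w
  | 2 => -v
  | _ => -w

theorem parallelogram_natCast_add (p v w : A) {k : ℕ} (hk : k < 4) {s : ℝ}
    (hs : s ∈ Icc (0 : ℝ) 1) :
    parallelogram p v w (k + s) =
      p + (parallelogramVertex v w k + s • parallelogramSide v w k) := by
  have ⟨h0, h1⟩ := hs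
  have hs' : 1 - s ∈ Icc (0 : ℝ) 1 := ⟨by linarith, by linarith⟩
  interval_cases k
  · rw [parallelogram, Nat.cast_zero, zero_add, trapezoid_of_mem_Icc_zero_one hs,
      trapezoid_of_nonpos (by linarith)]
    simp [parallelogramVertex, parallelogramSide]
  · rw [parallelogram,
      trapezoid_of_mem_Icc_one_two ⟨by push_cast; linarith, by push_cast; linarith⟩,
      Nat.cast_one, add_sub_cancel_left, trapezoid_of_mem_Icc_zero_one hs]
    simp [parallelogramVertex, parallelogramSide]
  · rw [parallelogram, ← trapezoid_three_sub,
      show (3 : ℝ) - ((2 : ℕ) + s) = 1 - s by push_cast; ring,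
      trapezoid_of_mem_Icc_zero_one hs',
      trapezoid_of_mem_Icc_one_two ⟨by push_cast; linarith, by push_cast; linarith⟩]
    simp only [parallelogramVertex, parallelogramSide]
    module
  · rw [parallelogram, ← trapezoid_three_sub, trapezoid_of_nonpos (by push_cast; linarith),
      ← trapezoid_three_sub, show (3 : ℝ) - ((3 : ℕ) + s - 1) = 1 - s by push_cast; ring,
      trapezoid_of_mem_Icc_zero_one hs']
    simp only [parallelogramVertex, parallelogramSide]
    module

theorem isPiecewiseSmooth_parallelogram (p v w : A) :
    IsPiecewiseSmooth (parallelogram p v w) 0 4 := by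
  refine ⟨4, Nat.cast, Nat.mono_cast, Nat.cast_zero, by norm_num, fun k hk ↦ ?_⟩
  have hsmooth : ContDiff ℝ 1 fun t : ℝ ↦
      p + (parallelogramVertex v w k + (t - k) • parallelogramSide v w k) := by fun_prop
  refine hsmooth.contDiffOn.congr fun t ht ↦ ?_
  rw [← parallelogram_natCast_add p v w hk, add_sub_cancel]
  push_cast at ht
  exact ⟨by linarith [ht.1], by linarith [ht.2]⟩

theorem isLoopIn_parallelogram {U : Set A} {p v w : A}
    (hU : Metric.closedBall p (‖v‖ + ‖w‖) ⊆ U) : IsLoopIn U (parallelogram p v w) 0 4 := by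
  refine ⟨by norm_num, (continuous_parallelogram p v w).continuousOn, fun t _ ↦ hU ?_, ?_⟩
  · rw [Metric.mem_closedBall, dist_eq_norm]
    exact norm_parallelogram_sub_le p v w t
  · rw [parallelogram, parallelogram, trapezoid_of_nonpos le_rfl, trapezoid_of_nonpos (by norm_num),
      ← trapezoid_three_sub 4, ← trapezoid_three_sub (4 - 1), trapezoid_of_nonpos (by norm_num),
      trapezoid_of_nonpos (by norm_num)]

theorem parallelogram_natCast_div (p v w : A) {k n i : ℕ} (hk : k < 4) (hn : 0 < n) (hi : i ≤ n) :
    parallelogram p v w ((n * k + i : ℕ) / n) =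
      p + (parallelogramVertex v w k + ((i : ℝ) / n) • parallelogramSide v w k) := by
  have hn' : (0 : ℝ) < n := by exact_mod_cast hn
  rw [← parallelogram_natCast_add p v w hk
    ⟨by positivity, (div_le_one hn').2 (by exact_mod_cast hi)⟩]
  congr 1
  push_cast
  field_simp

theorem parallelogram_succ_sub (p v w : A) {k n i : ℕ} (hk : k < 4) (hi : i < n) :
    parallelogram p v w ((n * k + i + 1 : ℕ) / n) - parallelogram p v w ((n * k + i : ℕ) / n) =
      (1 / n : ℝ) • parallelogramSide v w k := by
  have hn : 0 < n := by lia
  rw [add_assoc, parallelogram_natCast_div p v w hk hn hi,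
    parallelogram_natCast_div p v w hk hn hi.le]
  push_cast
  module

theorem sum_range_mul_eq_sum_sum {M : Type*} [AddCommMonoid M] (g : ℕ → M) (n m : ℕ) :
    ∑ i ∈ Finset.range (n * m), g i =
      ∑ k ∈ Finset.range m, ∑ i ∈ Finset.range n, g (n * k + i) := by
  induction m with
  | zero => simp
  | succ m ih => rw [Nat.mul_succ, Finset.sum_range_add, ih, Finset.sum_range_succ]

theorem sum_range_natCast_succ (n : ℕ) :
    ∑ i ∈ Finset.range n, ((i + 1 : ℕ) : ℝ) = n * (n + 1) / 2 := by
  induction n with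
  | zero => simp
  | succ n ih =>
    rw [Finset.sum_range_succ, ih]
    push_cast
    ring

/-- The Riemann sum of a linear function over the partition of a segment into `n` equal parts. -/
theorem sum_range_linear_segment (T : A →L[ℝ] A) (q u : A) {n : ℕ} (hn : 0 < n) :
    ∑ i ∈ Finset.range n, T (q + (((i + 1 : ℕ) : ℝ) / n) • u) * ((1 / n : ℝ) • u) =
      T q * u + ((n + 1) / (2 * n) : ℝ) • (T u * u) := by
  have hn' : (n : ℝ) ≠ 0 := by exact_mod_cast hn.ne'
  have hterm (i : ℕ) : T (q + (((i + 1 : ℕ) : ℝ) / n) • u) * ((1 / n : ℝ) • u) =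
      (1 / n : ℝ) • (T q * u) + (((i + 1 : ℕ) : ℝ) * (1 / (n * n))) • (T u * u) := by
    rw [map_add, map_smul, add_mul, smul_mul_smul_comm, mul_smul_comm]
    congr 2
    field_simp
  simp only [hterm, Finset.sum_add_distrib, ← Finset.sum_smul, ← Finset.sum_mul,
    sum_range_natCast_succ, Finset.sum_const, Finset.card_range, nsmul_eq_mul,
    mul_one_div_cancel hn', one_smul]
  congr 2
  field_simp

/-- The Riemann sums of a linear function around a parallelogram, over the partition of each side
into `n` equal parts. -/
theorem sum_range_linear_parallelogram (T : A →L[ℝ] A) (p v w : A) {n : ℕ} (hn : 0 < n) :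
    ∑ i ∈ Finset.range (n * 4), T (parallelogram p v w ((i + 1 : ℕ) / n) - p) *
        (parallelogram p v w ((i + 1 : ℕ) / n) - parallelogram p v w ((i : ℕ) / n)) =
      T v * w - T w * v + (1 / n : ℝ) • (T v * v + T w * w) := by
  have hn' : (n : ℝ) ≠ 0 := by exact_mod_cast hn.ne'
  rw [sum_range_mul_eq_sum_sum]
  have hside : ∀ k ∈ Finset.range 4, ∑ i ∈ Finset.range n,
      T (parallelogram p v w ((n * k + i + 1 : ℕ) / n) - p) *
        (parallelogram p v w ((n * k + i + 1 : ℕ) / n) -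
          parallelogram p v w ((n * k + i : ℕ) / n)) =
      T (parallelogramVertex v w k) * parallelogramSide v w k + ((n + 1) / (2 * n) : ℝ) •
        (T (parallelogramSide v w k) * parallelogramSide v w k) := fun k hk ↦ by
    have hk := Finset.mem_range.1 hk
    rw [← sum_range_linear_segment T _ _ hn]
    refine Finset.sum_congr rfl fun i hi ↦ ?_
    have hi := Finset.mem_range.1 hi
    rw [parallelogram_succ_sub p v w hk hi, add_assoc,
      parallelogram_natCast_div p v w hk hn hi, add_sub_cancel_left]
  rw [Finset.sum_congr rfl hside]
  simp only [Finset.sum_range_succ, Finset.sum_range_zero, parallelogramVertex, parallelogramSide,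
    map_add, map_neg, map_zero, add_mul, mul_neg, neg_mul, neg_neg, zero_mul]
  match_scalars <;> field_simp <;> ring

theorem sum_range_norm_parallelogram (p v w : A) {n : ℕ} (hn : 0 < n) :
    ∑ i ∈ Finset.range (n * 4),
        ‖parallelogram p v w ((i + 1 : ℕ) / n) - parallelogram p v w ((i : ℕ) / n)‖ =
      2 * (‖v‖ + ‖w‖) := by
  have hn' : (n : ℝ) ≠ 0 := by exact_mod_cast hn.ne'
  rw [sum_range_mul_eq_sum_sum]
  have hside : ∀ k ∈ Finset.range 4, ∑ i ∈ Finset.range n,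
      ‖parallelogram p v w ((n * k + i + 1 : ℕ) / n) - parallelogram p v w ((n * k + i : ℕ) / n)‖ =
      ‖parallelogramSide v w k‖ := fun k hk ↦ by
    rw [Finset.sum_congr rfl fun i hi ↦ by
      rw [parallelogram_succ_sub p v w (Finset.mem_range.1 hk) (Finset.mem_range.1 hi), norm_smul],
      Finset.sum_const, Finset.card_range, nsmul_eq_mul, ← mul_assoc, Real.norm_of_nonneg
        (by positivity), mul_one_div_cancel hn', one_mul]
  rw [Finset.sum_congr rfl hside]
  simp only [Finset.sum_range_succ, Finset.sum_range_zero, parallelogramSide, norm_neg]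
  ring

/-- If `f(ζ) ⋆ dζ` has integral zero around the parallelogram spanned by `v` and `w` at `p`, where
`f` is approximated by its linearization `f p + T (ζ - p)`, then `T v ⋆ w - T w ⋆ v`, the integral
of the linearization, is no larger than the error of the approximation allows. -/
theorem norm_mul_sub_mul_le_of_hasAIntegral_zero {f : A → A} {T : A →L[ℝ] A} {p v w : A} {η : ℝ}
    (hη : 0 ≤ η)
    (hf : ∀ x, ‖x - p‖ ≤ ‖v‖ + ‖w‖ → ‖f x - f p - T (x - p)‖ ≤ η * ‖x - p‖)
    (hI : HasAIntegral f (parallelogram p v w) 0 4 0) :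
    ‖T v * w - T w * v‖ ≤ 2 * η * (‖v‖ + ‖w‖) ^ 2 := by
  set γ := parallelogram p v w with hγ
  set B := ‖T v * v + T w * w‖ with hB
  refine le_of_forall_pos_le_add fun ε hε ↦ ?_
  obtain ⟨δ, hδ, hI⟩ := hI (ε / 2) (half_pos hε)
  obtain ⟨n, hn⟩ := exists_nat_gt (max (1 / δ) (B / (ε / 2)))
  rw [max_lt_iff] at hn
  have hn0 : (0 : ℝ) < n := (one_div_pos.2 hδ).trans hn.1
  have hn0' : 0 < n := by exact_mod_cast hn0
  have hsum := hI (n * 4) (fun i ↦ i / n) (fun i j hij ↦ by dsimp only; gcongr) (by simp)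
    (by push_cast; field_simp) fun i _ ↦ by
      rw [← sub_div, Nat.cast_succ, add_sub_cancel_left]
      exact (one_div_lt hδ hn0).1 hn.1
  rw [sub_zero] at hsum
  have hconst : ∑ i ∈ Finset.range (n * 4),
      f p * (γ ((i + 1 : ℕ) / n) - γ ((i : ℕ) / n)) = 0 := by
    rw [← Finset.mul_sum, Finset.sum_range_sub (fun i ↦ γ ((i : ℕ) / n))]
    have hloop : γ 0 = γ 4 := (isLoopIn_parallelogram (subset_univ _)).2.2.2
    rw [Nat.cast_zero, zero_div, show ((n * 4 : ℕ) : ℝ) / n = 4 by push_cast; field_simp,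
      hloop, sub_self, mul_zero]
  have herr : ‖∑ i ∈ Finset.range (n * 4),
      (f (γ ((i + 1 : ℕ) / n)) - f p - T (γ ((i + 1 : ℕ) / n) - p)) *
        (γ ((i + 1 : ℕ) / n) - γ ((i : ℕ) / n))‖ ≤ 2 * η * (‖v‖ + ‖w‖) ^ 2 := by
    calc _ ≤ ∑ i ∈ Finset.range (n * 4),
          η * (‖v‖ + ‖w‖) * ‖γ ((i + 1 : ℕ) / n) - γ ((i : ℕ) / n)‖ :=
          norm_sum_le_of_le _ fun i _ ↦ by
            have hle := norm_parallelogram_sub_le p v w ((i + 1 : ℕ) / n)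
            refine (norm_mul_le _ _).trans ?_
            gcongr
            exact (hf _ hle).trans (by gcongr)
      _ = _ := by
          rw [← Finset.mul_sum, sum_range_norm_parallelogram p v w hn0']
          ring
  have hlin := sum_range_linear_parallelogram T p v w hn0'
  rw [← hγ] at hlin
  have hB' : ‖(1 / n : ℝ) • (T v * v + T w * w)‖ ≤ ε / 2 := by
    rw [norm_smul, Real.norm_of_nonneg (by positivity), ← hB, one_div_mul_eq_div]
    exact ((div_lt_comm₀ (half_pos hε) hn0).1 hn.2).le
  -- The Riemann sum splits along `f ζ = f p + T (ζ - p) + error`, and the constant telescopes.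
  have key : T v * w - T w * v =
      (∑ i ∈ Finset.range (n * 4),
        f (γ ((i + 1 : ℕ) / n)) * (γ ((i + 1 : ℕ) / n) - γ ((i : ℕ) / n))) -
      (∑ i ∈ Finset.range (n * 4),
        (f (γ ((i + 1 : ℕ) / n)) - f p - T (γ ((i + 1 : ℕ) / n) - p)) *
          (γ ((i + 1 : ℕ) / n) - γ ((i : ℕ) / n))) -
      (1 / n : ℝ) • (T v * v + T w * w) := by
    rw [← add_sub_cancel_right (T v * w - T w * v) ((1 / n : ℝ) • (T v * v + T w * w)), ← hlin]
    simp only [sub_mul, Finset.sum_sub_distrib, hconst]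
    abel
  rw [key]
  refine (norm_sub_le _ _).trans ?_
  grw [norm_sub_le, hB', herr, hsum]
  linarith

/-- If `f(ζ) ⋆ dζ` has integral zero around small parallelograms at `p`, then the bilinear map
`(v, w) ↦ d_p f (v) ⋆ w` is symmetric; for `w = 1` this says that `d_p f` is multiplication by
`d_p f (1)`. -/
theorem aDifferentiableAt_of_hasAIntegral_parallelogram_zero {U : Set A} {f : A → A} {p : A}
    (hU : U ∈ nhds p) (hf : DifferentiableAt ℝ f p)
    (hI : ∀ v w : A, Metric.closedBall p (‖v‖ + ‖w‖) ⊆ U →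
      HasAIntegral f (parallelogram p v w) 0 4 0) : ADifferentiableAt f p := by
  set T := fderiv ℝ f p
  suffices h : ∀ v, T v = T 1 * v from
    ⟨T, fun x y ↦ by rw [h, h x, mul_assoc], hf.hasFDerivAt⟩
  intro v
  set K := ‖v‖ + ‖(1 : A)‖
  have hK : 0 ≤ K := by positivity
  rw [← sub_eq_zero, ← norm_le_zero_iff]
  refine le_of_forall_pos_le_add fun ε hε ↦ ?_
  have hη : 0 < ε / (2 * K ^ 2 + 1) := by positivity
  obtain ⟨r, hr, hball⟩ := Metric.eventually_nhds_iff.1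
    ((hf.hasFDerivAt.isLittleO.def hη).and hU)
  -- Shrink the parallelogram spanned by `v` and `1` by a factor `s` until it fits.
  obtain ⟨s, hs, hsK⟩ : ∃ s > 0, s * K < r := by
    refine ⟨r / (K + 1), by positivity, ?_⟩
    rw [div_mul_eq_mul_div, div_lt_iff₀ (by positivity)]
    nlinarith
  have hsize : ‖s • v‖ + ‖s • (1 : A)‖ = s * K := by
    rw [norm_smul, norm_smul, Real.norm_of_nonneg hs.le, mul_add]
  have hle := norm_mul_sub_mul_le_of_hasAIntegral_zero (T := T) hη.le
    (fun x hx ↦ (hball (by rw [dist_eq_norm]; linarith)).1)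
    (hI (s • v) (s • 1) fun x hx ↦ (hball (by
      rw [Metric.mem_closedBall] at hx; linarith)).2)
  rw [hsize, map_smul, map_smul, smul_mul_smul_comm, smul_mul_smul_comm, ← smul_sub, norm_smul,
    Real.norm_of_nonneg (by positivity), mul_one] at hle
  have hle' : ‖T v - T 1 * v‖ ≤ 2 * (ε / (2 * K ^ 2 + 1)) * K ^ 2 := by
    refine le_of_mul_le_mul_left (hle.trans_eq ?_) (mul_pos hs hs)
    ring
  refine hle'.trans ?_
  rw [zero_add, mul_right_comm, mul_div_assoc', div_le_iff₀ (by positivity)]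
  nlinarith

end AlgebraCalculus

theorem mainTheorem11 {A : Type*} [NormedCommRing A] [NormedAlgebra ℝ A] [FiniteDimensional ℝ A]
    (U : Set A) (hU : IsOpen U) (hsc : IsSimplyConnected U)
    (f : A → A) (hf : DifferentiableOn ℝ f U) :
    ((∀ (γ : ℝ → A) (a b : ℝ), AlgebraCalculus.IsLoopIn U γ a b →
        AlgebraCalculus.IsRectifiable γ a b → AlgebraCalculus.HasAIntegral f γ a b 0) ↔
      AlgebraCalculus.ADifferentiableOn f U) ∧
    ((∀ (γ : ℝ → A) (a b : ℝ), AlgebraCalculus.IsLoopIn U γ a b →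
        AlgebraCalculus.IsPiecewiseSmooth γ a b → AlgebraCalculus.HasAIntegral f γ a b 0) ↔
      AlgebraCalculus.ADifferentiableOn f U) := by
  have : CompleteSpace A := FiniteDimensional.complete ℝ A
  have hforward (h : ∀ (γ : ℝ → A) (a b : ℝ), AlgebraCalculus.IsLoopIn U γ a b →
      AlgebraCalculus.IsPiecewiseSmooth γ a b → AlgebraCalculus.HasAIntegral f γ a b 0) :
      AlgebraCalculus.ADifferentiableOn f U := fun p hp ↦
    AlgebraCalculus.aDifferentiableAt_of_hasAIntegral_parallelogram_zero (hU.mem_nhds hp)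
      (hf.differentiableAt (hU.mem_nhds hp)) fun v w hvw ↦
        h _ _ _ (AlgebraCalculus.isLoopIn_parallelogram hvw)
          (AlgebraCalculus.isPiecewiseSmooth_parallelogram p v w)
  have hback (h : AlgebraCalculus.ADifferentiableOn f U) (γ : ℝ → A) (a b : ℝ)
      (hγ : AlgebraCalculus.IsLoopIn U γ a b) (hr : AlgebraCalculus.IsRectifiable γ a b) :
      AlgebraCalculus.HasAIntegral f γ a b 0 := h.hasAIntegral_zero hU hsc hγ hr
  exact ⟨⟨fun h ↦ hforward fun γ a b hγ hs ↦ h γ a b hγ hs.isRectifiable, hback⟩,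
    ⟨hforward, fun h γ a b hγ hs ↦ hback h γ a b hγ hs.isRectifiable⟩⟩
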